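/- Let $n\ge 0$ be an integer and let $\mathcal T_n$ be the space of real antisymmetric $n\times n$ matrices with its usual topology. Let $O(n,n|\mathbf R)$ be the group of linear transformations of $\mathbf R^{2n}$, with coordinates $(a^1,\dots,a^n,b_1,\dots,b_n)$, that preserve the quadratic form $\sum_i a^ib_i$, and let $SO(n,n|\mathbf Z)$ be its subgroup of matrices with integer entries and determinant $+1$. For $g=\begin{pmatrix}A&B\\ C&D\end{pmatrix}\in SO(n,n|\mathbf Z)$ (with $n\times n$ blocks) and $\theta\in\mathcal T_n$, say that $g\theta$ is defined if $C\theta+D$ is invertible, and then put $g\theta=(A\theta+B)(C\theta+D)^{-1}$. Let $$\mathcal T_n^0=\{\theta\in\mathcal T_n : g\theta \text{ is defined for all } g\in SO(n,n|\mathbf Z)\}.$$ Then $\mathcal T_n^0$ is dense in $\mathcal T_n$ and of the second category in $\mathcal T_n$ (that is, it is not a countable union of nowhere dense subsets of $\mathcal T_n$). Moreover, $\mathcal T_n^0$ is invariant under $SO(n,n|\mathbf Z)$: for every $g\in SO(n,n|\mathbf Z)$ one has $\{g\theta:\theta\in\mathcal T_n^0\}=\mathcal T_n^0$, and $(g,\theta)\mapsto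 g\theta$ is an action of the group $SO(n,n|\mathbf Z)$ on $\mathcal T_n^0$. -/

import Mathlib

open Matrix

namespace SplitOrthogonal

/-- The space `𝒯_n` of real antisymmetric `n × n` matrices, with the topology induced from the
space of all real `n × n` matrices. -/
abbrev Antisymm (n : ℕ) : Type :=
  {θ : Matrix (Fin n) (Fin n) ℝ // θᵀ = -θ}

/-- The quadratic form `a¹b₁ + ⋯ + aⁿbₙ` on `ℝ²ⁿ`, with coordinates `(a¹,…,aⁿ,b₁,…,bₙ)`. -/
def splitForm (n : ℕ) (v : Fin n ⊕ Fin n → ℝ) : ℝ :=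
  ∑ i : Fin n, v (Sum.inl i) * v (Sum.inr i)

/-- The group `O(n,n|ℝ)` of linear transformations of `ℝ²ⁿ` preserving `splitForm n`. -/
def realO (n : ℕ) : Subgroup (GL (Fin n ⊕ Fin n) ℝ) where
  carrier := {g | ∀ v : Fin n ⊕ Fin n → ℝ, splitForm n (g.1 *ᵥ v) = splitForm n v}
  one_mem' := by
    intro v
    simp
  mul_mem' := by
    intro g h hg hh v
    rw [Units.val_mul, ← Matrix.mulVec_mulVec, hg, hh]
  inv_mem' := by
    intro g hg v
    rw [← hg, Matrix.mulVec_mulVec, ← Units.val_mul, mul_inv_cancel, Units.val_one,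
      Matrix.one_mulVec]

/-- The group `SO(n,n|ℤ)`: integer matrices of determinant `1` which, viewed as real matrices,
lie in `O(n,n|ℝ)`. -/
def integerSO (n : ℕ) : Subgroup (SpecialLinearGroup (Fin n ⊕ Fin n) ℤ) :=
  (realO n).comap (SpecialLinearGroup.mapGL ℝ)

/-- An element of `SO(n,n|ℤ)` as a real `2n × 2n` matrix, in `2 × 2` block form. -/
def toRealMatrix {n : ℕ} (g : integerSO n) : Matrix (Fin n ⊕ Fin n) (Fin n ⊕ Fin n) ℝ :=
  g.1.1.map (fun k : ℤ => (k : ℝ))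

/-- The numerator `Aθ + B`, for `g = (A B; C D)`. -/
def numer {n : ℕ} (g : integerSO n) (θ : Antisymm n) : Matrix (Fin n) (Fin n) ℝ :=
  (toRealMatrix g).toBlocks₁₁ * θ.1 + (toRealMatrix g).toBlocks₁₂

/-- The denominator `Cθ + D`, for `g = (A B; C D)`. -/
def denom {n : ℕ} (g : integerSO n) (θ : Antisymm n) : Matrix (Fin n) (Fin n) ℝ :=
  (toRealMatrix g).toBlocks₂₁ * θ.1 + (toRealMatrix g).toBlocks₂₂

/-- `gθ` is defined when `Cθ + D` is invertible. -/
def IsDefinedAt {n : ℕ} (g : integerSO n) (θ : Antisymm n) : Prop :=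
  IsUnit (denom g θ)

/-- The matrix `gθ = (Aθ + B)(Cθ + D)⁻¹` (meaningful when `IsDefinedAt g θ`). -/
noncomputable def fracAct {n : ℕ} (g : integerSO n) (θ : Antisymm n) :
    Matrix (Fin n) (Fin n) ℝ :=
  numer g θ * (denom g θ)⁻¹

/-- The set `𝒯_n⁰` of all `θ ∈ 𝒯_n` such that `gθ` is defined for all `g ∈ SO(n,n|ℤ)`. -/
def antisymmZero (n : ℕ) : Set (Antisymm n) :=
  {θ | ∀ g : integerSO n, IsDefinedAt g θ}

end SplitOrthogonal

namespace SplitOrthogonal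

/-! For fixed `g` the set where `Cθ + D` is invertible is open. It is dense once nonempty, because
`det (Cθ + D)` is polynomial along lines. The group is countable and `Antisymm n` is a Baire space,
so `antisymmZero n` is residual.

The crux is nonemptiness (`exists_isUnit_denom`), where determinant `1` matters. Let `U` have as
columns an orthonormal basis of `ker D`. Then `θ = U N Uᵀ` works for every invertible antisymmetric
`N`, and such an `N` exists when `dim ker D` is even. If it is odd, composing `g` with a reflection
of determinant `-1` gives a matrix with an invertible denominator somewhere, and this forces
determinant `1`: a contradiction.

The action follows from the cocycle identity `denom_mul`. -/

/-! ### The split form and its polarization -/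

/-- The Gram matrix of the polarization of `splitForm n`. -/
def splitGram (n : ℕ) : Matrix (Fin n ⊕ Fin n) (Fin n ⊕ Fin n) ℝ :=
  fromBlocks 0 1 1 0

/-- `M` preserves the bilinear form with Gram matrix `splitGram n`. -/
def PreservesGram {n : ℕ} (M : Matrix (Fin n ⊕ Fin n) (Fin n ⊕ Fin n) ℝ) : Prop :=
  Mᵀ * splitGram n * M = splitGram n

theorem PreservesGram.mul {n : ℕ} {M N : Matrix (Fin n ⊕ Fin n) (Fin n ⊕ Fin n) ℝ}
    (hM : PreservesGram M) (hN : PreservesGram N) : PreservesGram (M * N) := by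
  unfold PreservesGram at *
  calc (M * N)ᵀ * splitGram n * (M * N) = Nᵀ * (Mᵀ * splitGram n * M) * N := by
        simp only [transpose_mul, Matrix.mul_assoc]
    _ = splitGram n := by rw [hM, hN]

theorem preservesGram_fromBlocks_iff {n : ℕ} {A B C D : Matrix (Fin n) (Fin n) ℝ} :
    PreservesGram (fromBlocks A B C D) ↔
      Cᵀ * A + Aᵀ * C = 0 ∧ Cᵀ * B + Aᵀ * D = 1 ∧ Dᵀ * A + Bᵀ * C = 1 ∧
        Dᵀ * B + Bᵀ * D = 0 := by
  unfold PreservesGram splitGram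
  rw [fromBlocks_transpose, fromBlocks_multiply, fromBlocks_multiply, fromBlocks_inj]
  simp

theorem splitForm_add {n : ℕ} (v w : Fin n ⊕ Fin n → ℝ) :
    splitForm n (v + w) = splitForm n v + splitForm n w + v ⬝ᵥ (splitGram n *ᵥ w) := by
  simp only [splitForm, splitGram, dotProduct, Fintype.sum_sum_type, fromBlocks_mulVec]
  simp only [← Finset.sum_add_distrib]
  refine Finset.sum_congr rfl fun i _ => ?_
  simp
  ring

theorem preservesGram_of_splitForm {n : ℕ} {M : Matrix (Fin n ⊕ Fin n) (Fin n ⊕ Fin n) ℝ}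
    (hM : ∀ v, splitForm n (M *ᵥ v) = splitForm n v) : PreservesGram M := by
  have key : ∀ v w, v ⬝ᵥ ((Mᵀ * splitGram n * M) *ᵥ w) = v ⬝ᵥ (splitGram n *ᵥ w) := by
    intro v w
    have h := hM (v + w)
    rw [mulVec_add, splitForm_add, splitForm_add, hM, hM] at h
    rw [← mulVec_mulVec, ← mulVec_mulVec, dotProduct_mulVec v Mᵀ, vecMul_transpose]
    linarith
  ext i j
  simpa using key (Pi.single i 1) (Pi.single j 1)

theorem preservesGram_toRealMatrix {n : ℕ} (g : integerSO n) : PreservesGram (toRealMatrix g) :=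
  preservesGram_of_splitForm g.2

theorem det_toRealMatrix {n : ℕ} (g : integerSO n) : (toRealMatrix g).det = 1 := by
  have h := (Int.castRingHom ℝ).map_det g.1.1
  rw [g.1.2] at h
  simpa [toRealMatrix] using h.symm

/-! ### Translations, reflections and determinants -/

/-- The translation `θ ↦ θ + η` as a block matrix. -/
theorem preservesGram_translation {n : ℕ} {η : Matrix (Fin n) (Fin n) ℝ} (hη : ηᵀ = -η) :
    PreservesGram (fromBlocks 1 η 0 1) := by
  rw [preservesGram_fromBlocks_iff]
  simp [hη]

/-- The orthogonality relations make the Schur complement `A - B D⁻¹ C` inverse to `Dᵀ`, so the two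
determinants cancel. -/
theorem det_eq_one_of_isUnit {n : ℕ} {A B C D : Matrix (Fin n) (Fin n) ℝ}
    (h : PreservesGram (fromBlocks A B C D)) (hD : IsUnit D) : (fromBlocks A B C D).det = 1 := by
  obtain ⟨-, -, h1, h2⟩ := preservesGram_fromBlocks_iff.1 h
  let _ := hD.invertible
  rw [det_fromBlocks₂₂]
  have h3 : Dᵀ * (A - B * ⅟D * C) = 1 := by
    have h2' : Dᵀ * B = -(Bᵀ * D) := eq_neg_of_add_eq_zero_left h2
    calc Dᵀ * (A - B * ⅟D * C) = Dᵀ * A - Dᵀ * B * ⅟D * C := by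
          simp only [Matrix.mul_sub, Matrix.mul_assoc]
      _ = Dᵀ * A + Bᵀ * (D * ⅟D) * C := by
          rw [h2']; simp only [Matrix.neg_mul, sub_neg_eq_add, Matrix.mul_assoc]
      _ = 1 := by rw [mul_invOf_self, Matrix.mul_one, h1]
  rw [← det_transpose D, ← det_mul, h3, det_one]

theorem det_eq_one_of_isUnit_translate {n : ℕ} {A B C D η : Matrix (Fin n) (Fin n) ℝ}
    (h : PreservesGram (fromBlocks A B C D)) (hη : ηᵀ = -η) (hD : IsUnit (C * η + D)) :
    (fromBlocks A B C D).det = 1 := by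
  have h1 := h.mul (preservesGram_translation hη)
  have h2 : fromBlocks A B C D * fromBlocks 1 η 0 1 = fromBlocks A (A * η + B) C (C * η + D) := by
    simp [fromBlocks_multiply]
  rw [h2] at h1
  have h3 := det_eq_one_of_isUnit h1 hD
  rw [← h2, det_mul, det_fromBlocks_zero₂₁] at h3
  simpa using h3

/-- The reflection exchanging `(u, 0)` and `(0, u)`, where `P = u uᵀ` for a unit vector `u`. -/
theorem preservesGram_reflection {n : ℕ} {P : Matrix (Fin n) (Fin n) ℝ} (hP : Pᵀ = P)
    (hPP : P * P = P) : PreservesGram (fromBlocks (1 - P) P P (1 - P)) := by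
  rw [preservesGram_fromBlocks_iff]
  simp [hP, Matrix.mul_sub, Matrix.sub_mul, hPP]

theorem det_reflection {n : ℕ} {u : Matrix (Fin n) Unit ℝ} (hu : uᵀ * u = 1) :
    (fromBlocks (1 - u * uᵀ) (u * uᵀ) (u * uᵀ) (1 - u * uᵀ)).det = -1 := by
  set P := u * uᵀ
  -- Adding the second block column to the first turns the first into identities; the Schur
  -- complement is then `1 - 2uuᵀ`, of determinant `1 - 2`.
  have h : (fromBlocks (1 - P) P P (1 - P) * fromBlocks 1 0 1 1).det
      = (fromBlocks (1 - P) P P (1 - P)).det := by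
    rw [det_mul, det_fromBlocks_zero₁₂]; simp
  rw [← h, fromBlocks_multiply]
  simp only [Matrix.mul_one, Matrix.mul_zero, zero_add, sub_add_cancel, add_sub_cancel]
  rw [det_fromBlocks_one₁₁]
  have h1 : 1 - P - 1 * P = 1 + u * ((-2 : ℝ) • uᵀ) := by
    rw [Matrix.mul_smul, Matrix.one_mul]; module
  rw [h1, det_one_add_mul_comm, Matrix.smul_mul, hu]
  simp
  norm_num

/-! ### Points where the denominator is invertible -/

/-- A subspace of `ℝⁿ` is the column space of a matrix with orthonormal columns. -/
theorem exists_orthonormal_columns {n : ℕ} (K : Submodule ℝ (EuclideanSpace ℝ (Fin n))) :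
    ∃ (k : ℕ) (U : Matrix (Fin n) (Fin k) ℝ), Uᵀ * U = 1 ∧ (∀ j, WithLp.toLp 2 (Uᵀ j) ∈ K) ∧
      ∀ x, WithLp.toLp 2 x ∈ K → ∃ y, x = U *ᵥ y := by
  obtain ⟨k, ⟨b⟩⟩ : ∃ k, Nonempty (OrthonormalBasis (Fin k) ℝ K) :=
    ⟨_, ⟨stdOrthonormalBasis ℝ K⟩⟩
  refine ⟨k, Matrix.of fun i j => (b j : EuclideanSpace ℝ (Fin n)) i, ?_, ?_, ?_⟩
  · ext i j
    have h := orthonormal_iff_ite.1 b.orthonormal i j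
    rw [Submodule.coe_inner, PiLp.inner_apply] at h
    rw [Matrix.mul_apply, Matrix.one_apply, ← h]
    refine Finset.sum_congr rfl fun l _ => ?_
    simp [mul_comm]
  · exact fun j => (b j).2
  · intro x hx
    refine ⟨fun j => b.repr ⟨_, hx⟩ j, ?_⟩
    have h := congrArg (fun v : K => (v : EuclideanSpace ℝ (Fin n))) (b.sum_repr ⟨_, hx⟩)
    ext i
    have h' := congrArg (fun v : EuclideanSpace ℝ (Fin n) => v i) h
    simp only [AddSubmonoidClass.coe_finsetSum, Submodule.coe_smul, WithLp.ofLp_sum,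
      Finset.sum_apply, PiLp.smul_apply, smul_eq_mul] at h'
    rw [← h', mulVec, dotProduct]
    exact Finset.sum_congr rfl fun j _ => mul_comm _ _

theorem exists_orthonormal_kernel {n : ℕ} (D : Matrix (Fin n) (Fin n) ℝ) :
    ∃ (k : ℕ) (U : Matrix (Fin n) (Fin k) ℝ), Uᵀ * U = 1 ∧ D * U = 0 ∧
      ∀ x, D *ᵥ x = 0 → ∃ y, x = U *ᵥ y := by
  have hmem : ∀ x, WithLp.toLp 2 x ∈ LinearMap.ker (toEuclideanLin D) ↔ D *ᵥ x = 0 := by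
    intro x
    rw [LinearMap.mem_ker, toLpLin_toLp, WithLp.toLp_eq_zero, toLin'_apply]
  obtain ⟨k, U, hU, hK, hspan⟩ := exists_orthonormal_columns (LinearMap.ker (toEuclideanLin D))
  refine ⟨k, U, hU, ?_, fun x hx => hspan x ((hmem x).2 hx)⟩
  ext i j
  exact congrFun ((hmem _).1 (hK j)) i

/-- Multiplying on the left by `UᵀBᵀ` kills `D` and turns `C` into `Uᵀ`. Hence a null vector `x`
satisfies `N Uᵀ x = 0`, so it is orthogonal to `ker D`; then `D x = 0` as well, and `x = 0`. -/
theorem isUnit_add_of_kernel {n k : ℕ} {A B C D : Matrix (Fin n) (Fin n) ℝ}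
    (h : PreservesGram (fromBlocks A B C D)) {U : Matrix (Fin n) (Fin k) ℝ} (hU : Uᵀ * U = 1)
    (hDU : D * U = 0) (hker : ∀ x, D *ᵥ x = 0 → ∃ y, x = U *ᵥ y)
    {N : Matrix (Fin k) (Fin k) ℝ} (hN : IsUnit N) : IsUnit (C * (U * N * Uᵀ) + D) := by
  obtain ⟨-, -, h1, h2⟩ := preservesGram_fromBlocks_iff.1 h
  have hUD : Uᵀ * Dᵀ = 0 := by rw [← transpose_mul, hDU, transpose_zero]
  have hWD : Uᵀ * Bᵀ * D = 0 := by
    rw [Matrix.mul_assoc, eq_neg_of_add_eq_zero_right h2, Matrix.mul_neg, ← Matrix.mul_assoc, hUD,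
      Matrix.zero_mul, neg_zero]
  have hWC : Uᵀ * Bᵀ * C = Uᵀ := by
    rw [Matrix.mul_assoc, eq_sub_of_add_eq' h1, Matrix.mul_sub, ← Matrix.mul_assoc, hUD]
    simp
  have hW : Uᵀ * Bᵀ * (C * (U * N * Uᵀ) + D) = N * Uᵀ := by
    rw [Matrix.mul_add, hWD, add_zero, ← Matrix.mul_assoc, hWC, ← Matrix.mul_assoc,
      ← Matrix.mul_assoc, hU, Matrix.one_mul]
  rw [← mulVec_injective_iff_isUnit]
  refine (injective_iff_map_eq_zero (mulVecLin (C * (U * N * Uᵀ) + D))).2 fun x hx => ?_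
  rw [mulVecLin_apply] at hx
  have h3 : N *ᵥ (Uᵀ *ᵥ x) = 0 := by
    rw [mulVec_mulVec, ← hW, ← mulVec_mulVec, hx, mulVec_zero]
  have h4 : Uᵀ *ᵥ x = 0 := mulVec_injective_iff_isUnit.2 hN (by rw [h3, mulVec_zero])
  have h5 : D *ᵥ x = 0 := by
    rw [add_mulVec, ← mulVec_mulVec, ← mulVec_mulVec, h4, mulVec_zero, mulVec_zero, zero_add] at hx
    exact hx
  obtain ⟨y, rfl⟩ := hker x h5
  rw [mulVec_mulVec, hU, one_mulVec] at h4
  rw [h4, mulVec_zero]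

theorem exists_isUnit_antisymm {k : ℕ} (hk : Even k) :
    ∃ N : Matrix (Fin k) (Fin k) ℝ, Nᵀ = -N ∧ IsUnit N := by
  obtain ⟨m, rfl⟩ := hk
  refine ⟨reindex finSumFinEquiv finSumFinEquiv (Matrix.J (Fin m) ℝ), ?_, ?_⟩
  · rw [transpose_reindex, J_transpose]; rfl
  · rw [isUnit_iff_isUnit_det, det_reindex_self]
    exact isUnit_det_J (Fin m) ℝ

theorem exists_isUnit_antisymm_add {k : ℕ} (hk : Odd k) :
    ∃ (N : Matrix (Fin k) (Fin k) ℝ) (e : Matrix (Fin k) Unit ℝ), Nᵀ = -N ∧ eᵀ * e = 1 ∧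
      eᵀ * N = 0 ∧ IsUnit (N + e * eᵀ) := by
  obtain ⟨m, rfl⟩ := hk
  obtain ⟨J, hJ, hJu⟩ := exists_isUnit_antisymm (even_two_mul m)
  let σ : Fin (2 * m) ⊕ Unit ≃ Fin (2 * m + 1) := Fintype.equivFinOfCardEq (by simp)
  let e : Matrix (Fin (2 * m) ⊕ Unit) Unit ℝ := fromRows 0 1
  let N : Matrix (Fin (2 * m) ⊕ Unit) (Fin (2 * m) ⊕ Unit) ℝ := fromBlocks J 0 0 0
  have hN : Nᵀ = -N := by simp [N, fromBlocks_transpose, fromBlocks_neg, hJ]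
  have he : eᵀ * e = 1 := by simp [e, transpose_fromRows, fromCols_mul_fromRows]
  have heN : eᵀ * N = 0 := by simp [e, N, transpose_fromRows, fromCols_mul_fromBlocks]
  have hNe : IsUnit (N + e * eᵀ) := by
    have h : N + e * eᵀ = fromBlocks J 0 0 1 := by
      rw [transpose_fromRows, fromRows_mul_fromCols, fromBlocks_add]
      simp
    rw [h, isUnit_iff_isUnit_det, det_fromBlocks_zero₂₁, det_one, mul_one]
    exact (isUnit_iff_isUnit_det _).1 hJu
  refine ⟨N.submatrix σ.symm σ.symm, e.submatrix σ.symm id, ?_, ?_, ?_, ?_⟩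
  · rw [transpose_submatrix, hN]; rfl
  · rw [transpose_submatrix, submatrix_mul_equiv, he, submatrix_id_id]
  · rw [transpose_submatrix, submatrix_mul_equiv, heN]; rfl
  · rw [transpose_submatrix, ← submatrix_mul _ _ _ id _ Function.bijective_id]
    exact (isUnit_submatrix_equiv σ.symm σ.symm).2 hNe

/-- An element of determinant `1` is defined at some antisymmetric matrix. -/
theorem exists_isUnit_denom {n : ℕ} {A B C D : Matrix (Fin n) (Fin n) ℝ}
    (h : PreservesGram (fromBlocks A B C D)) (hdet : (fromBlocks A B C D).det = 1) :
    ∃ θ : Matrix (Fin n) (Fin n) ℝ, θᵀ = -θ ∧ IsUnit (C * θ + D) := by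
  obtain ⟨k, U, hU, hDU, hker⟩ := exists_orthonormal_kernel D
  rcases Nat.even_or_odd k with hk | hk
  · obtain ⟨N, hN, hNu⟩ := exists_isUnit_antisymm hk
    exact ⟨U * N * Uᵀ, by simp [transpose_mul, hN, Matrix.mul_assoc],
      isUnit_add_of_kernel h hU hDU hker hNu⟩
  · exfalso
    obtain ⟨N, e, hN, he, heN, hNu⟩ := exists_isUnit_antisymm_add hk
    have hu : (U * e)ᵀ * (U * e) = 1 := by
      rw [transpose_mul, Matrix.mul_assoc, ← Matrix.mul_assoc Uᵀ, hU, Matrix.one_mul, he]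
    have hθ : (U * N * Uᵀ)ᵀ = -(U * N * Uᵀ) := by simp [transpose_mul, hN, Matrix.mul_assoc]
    have huθ : (U * e)ᵀ * (U * N * Uᵀ) = 0 := by
      rw [transpose_mul, ← Matrix.mul_assoc, ← Matrix.mul_assoc, Matrix.mul_assoc eᵀ, hU,
        Matrix.mul_one, heN, Matrix.zero_mul]
    have hunit := isUnit_add_of_kernel h hU hDU hker hNu
    have hd := det_reflection hu
    have hPP : U * e * (U * e)ᵀ * (U * e * (U * e)ᵀ) = U * e * (U * e)ᵀ := by
      rw [Matrix.mul_assoc, ← Matrix.mul_assoc (U * e)ᵀ, hu, Matrix.one_mul]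
    have hR := h.mul (preservesGram_reflection (P := U * e * (U * e)ᵀ) (by simp) hPP)
    have hDP : D * (U * e * (U * e)ᵀ) = 0 := by
      rw [← Matrix.mul_assoc, ← Matrix.mul_assoc, hDU, Matrix.zero_mul, Matrix.zero_mul]
    have hPθ : U * e * (U * e)ᵀ * (U * N * Uᵀ) = 0 := by
      rw [Matrix.mul_assoc, huθ, Matrix.mul_zero]
    have hP : U * (N + e * eᵀ) * Uᵀ = U * N * Uᵀ + U * e * (U * e)ᵀ := by
      simp only [transpose_mul, Matrix.mul_add, Matrix.add_mul, Matrix.mul_assoc]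
    rw [hP] at hunit
    generalize U * e * (U * e)ᵀ = P at *
    have hdet' := det_mul (fromBlocks A B C D) (fromBlocks (1 - P) P P (1 - P))
    rw [hdet, hd] at hdet'
    rw [fromBlocks_multiply] at hR hdet'
    rw [det_eq_one_of_isUnit_translate hR hθ] at hdet'
    · norm_num at hdet'
    -- As `D P = 0` and `P θ = 0`, the denominator of the reflected matrix at `θ` is `C (θ + P) +
    -- D`.
    · convert hunit using 1
      generalize U * N * Uᵀ = θ at hPθ
      simp only [Matrix.mul_sub, Matrix.add_mul, Matrix.sub_mul, Matrix.mul_add, hDP,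
        Matrix.mul_assoc, hPθ, Matrix.mul_zero, Matrix.zero_mul, Matrix.mul_one]
      abel

theorem exists_isDefinedAt {n : ℕ} (g : integerSO n) : ∃ θ : Antisymm n, IsDefinedAt g θ := by
  have h := preservesGram_toRealMatrix g
  have hd := det_toRealMatrix g
  rw [← fromBlocks_toBlocks (toRealMatrix g)] at h hd
  obtain ⟨θ, hθ, hu⟩ := exists_isUnit_denom h hd
  exact ⟨⟨θ, hθ⟩, hu⟩

/-! ### Density and Baire category -/

theorem continuous_denom {n : ℕ} (g : integerSO n) : Continuous (denom g) := by
  unfold denom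
  fun_prop

theorem isDefinedAt_iff {n : ℕ} (g : integerSO n) (θ : Antisymm n) :
    IsDefinedAt g θ ↔ (denom g θ).det ≠ 0 := by
  rw [IsDefinedAt, isUnit_iff_isUnit_det, isUnit_iff_ne_zero]

theorem isOpen_isDefinedAt {n : ℕ} (g : integerSO n) : IsOpen {θ | IsDefinedAt g θ} := by
  simp only [isDefinedAt_iff]
  exact isOpen_ne_fun (continuous_denom g).matrix_det continuous_const

theorem exists_polynomial_eval_eq_det {n : ℕ} (M N : Matrix (Fin n) (Fin n) ℝ) :
    ∃ p : Polynomial ℝ, ∀ t : ℝ, p.eval t = (M + t • N).det := by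
  refine ⟨(M.map Polynomial.C + (Polynomial.X : Polynomial ℝ) • N.map Polynomial.C).det,
    fun t => ?_⟩
  rw [← Polynomial.coe_evalRingHom, RingHom.map_det]
  congr 1
  ext i j
  simp [mul_comm t]

theorem dense_isDefinedAt {n : ℕ} (g : integerSO n) : Dense {θ | IsDefinedAt g θ} := by
  intro θ
  obtain ⟨η, hη⟩ := exists_isDefinedAt g
  -- The line from `θ` at `t = 0` to the good point `η` at `t = 1`: the determinant along it has
  -- finitely many roots, so good points accumulate at `θ`.
  let γ : ℝ → Antisymm n := fun t => ⟨θ.1 + t • (η.1 - θ.1), by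
    rw [transpose_add, transpose_smul, transpose_sub, θ.2, η.2]; module⟩
  have hγ : Continuous γ := by
    refine Continuous.subtype_mk ?_ _
    fun_prop
  obtain ⟨p, hp⟩ := exists_polynomial_eval_eq_det (denom g θ)
    ((toRealMatrix g).toBlocks₂₁ * (η.1 - θ.1))
  have hpγ : ∀ t, p.eval t = (denom g (γ t)).det := by
    intro t
    rw [hp]
    congr 1
    simp only [denom, γ, Matrix.mul_add, Matrix.mul_smul]
    abel
  have hp0 : p ≠ 0 := by
    rintro rfl
    have h1 := hpγ 1
    have h2 : γ 1 = η := by ext; simp [γ]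
    rw [h2, Polynomial.eval_zero] at h1
    exact (isDefinedAt_iff g η).1 hη h1.symm
  have hfin : Set.Finite {t | p.IsRoot t} := Polynomial.finite_setOfPred_isRoot hp0
  have hdense : Dense {t | p.IsRoot t}ᶜ := hfin.countable.dense_compl ℝ
  have hγ0 : γ 0 = θ := by ext; simp [γ]
  rw [← hγ0]
  refine map_mem_closure hγ (hdense 0) fun t ht => ?_
  rw [Set.mem_ofPred_eq, isDefinedAt_iff, ← hpγ]
  exact ht

theorem isClosed_antisymm (n : ℕ) : IsClosed {θ : Matrix (Fin n) (Fin n) ℝ | θᵀ = -θ} :=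
  isClosed_eq (by fun_prop) (by fun_prop)

instance baireSpace_antisymm (n : ℕ) : BaireSpace (Antisymm n) := by
  have : LocallyCompactSpace (Matrix (Fin n) (Fin n) ℝ) :=
    inferInstanceAs (LocallyCompactSpace (Fin n → Fin n → ℝ))
  have : LocallyCompactSpace (Antisymm n) :=
    (isClosed_antisymm n).isClosedEmbedding_subtypeVal.locallyCompactSpace
  infer_instance

instance countable_integerSO (n : ℕ) : Countable (integerSO n) := by
  have : Countable (Matrix (Fin n ⊕ Fin n) (Fin n ⊕ Fin n) ℤ) :=
    inferInstanceAs (Countable (Fin n ⊕ Fin n → Fin n ⊕ Fin n → ℤ))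
  have : Countable (SpecialLinearGroup (Fin n ⊕ Fin n) ℤ) :=
    inferInstanceAs (Countable {M : Matrix (Fin n ⊕ Fin n) (Fin n ⊕ Fin n) ℤ // M.det = 1})
  infer_instance

theorem antisymmZero_mem_residual (n : ℕ) : antisymmZero n ∈ residual (Antisymm n) := by
  have h : antisymmZero n = ⋂ g : integerSO n, {θ | IsDefinedAt g θ} := by
    ext; simp [antisymmZero]
  rw [h, countable_iInter_mem]
  exact fun g => residual_of_dense_open (isOpen_isDefinedAt g) (dense_isDefinedAt g)

theorem not_isMeagre_antisymmZero (n : ℕ) : ¬ IsMeagre (antisymmZero n) := by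
  intro h
  have h1 : (∅ : Set (Antisymm n)) ∈ residual (Antisymm n) := by
    simpa using Filter.inter_mem (antisymmZero_mem_residual n) h
  obtain ⟨θ, hθ⟩ := (dense_of_mem_residual h1).nonempty_iff.2 ⟨⟨0, by simp⟩⟩
  exact hθ

/-! ### The fractional linear action -/

/-- Numerator and denominator form the right block column of `g` times the translation by `θ`; the
isotropy of that column is the antisymmetry sought. -/
theorem transpose_fracAct {n : ℕ} {g : integerSO n} {θ : Antisymm n} (h : IsDefinedAt g θ) :
    (fracAct g θ)ᵀ = -fracAct g θ := by
  have hg := (preservesGram_toRealMatrix g)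
  rw [← fromBlocks_toBlocks (toRealMatrix g)] at hg
  have hg' := hg.mul (preservesGram_translation θ.2)
  rw [fromBlocks_multiply, preservesGram_fromBlocks_iff] at hg'
  simp only [Matrix.mul_one] at hg'
  have h1 : (denom g θ)ᵀ * numer g θ = -((numer g θ)ᵀ * denom g θ) :=
    eq_neg_of_add_eq_zero_left hg'.2.2.2
  have hd : IsUnit (denom g θ).det := (isUnit_iff_isUnit_det _).1 h
  have hdt : IsUnit (denom g θ)ᵀ.det := by rwa [det_transpose]
  rw [fracAct, transpose_mul, transpose_nonsing_inv]
  calc (denom g θ)ᵀ⁻¹ * (numer g θ)ᵀ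
      = (denom g θ)ᵀ⁻¹ * ((numer g θ)ᵀ * denom g θ) * (denom g θ)⁻¹ := by
        rw [Matrix.mul_assoc, Matrix.mul_assoc, mul_nonsing_inv _ hd, Matrix.mul_one]
    _ = -(numer g θ * (denom g θ)⁻¹) := by
        rw [← neg_eq_iff_eq_neg.2 h1, Matrix.mul_neg, ← Matrix.mul_assoc,
          nonsing_inv_mul _ hdt, Matrix.one_mul, Matrix.neg_mul]

theorem toRealMatrix_mul {n : ℕ} (g h : integerSO n) :
    toRealMatrix (g * h) = toRealMatrix g * toRealMatrix h :=
  Matrix.map_mul (f := Int.castRingHom ℝ)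

theorem toRealMatrix_one {n : ℕ} : toRealMatrix (1 : integerSO n) = 1 :=
  Matrix.map_one (Int.castRingHom ℝ) (map_zero _) (map_one _)

/-- `gθ` as an antisymmetric matrix. -/
noncomputable def moebius {n : ℕ} (g : integerSO n) (θ : Antisymm n) (h : IsDefinedAt g θ) :
    Antisymm n :=
  ⟨fracAct g θ, transpose_fracAct h⟩

theorem fracAct_mul_denom {n : ℕ} {g : integerSO n} {θ : Antisymm n} (h : IsDefinedAt g θ) :
    fracAct g θ * denom g θ = numer g θ := by
  rw [fracAct, Matrix.mul_assoc, nonsing_inv_mul _ ((isUnit_iff_isUnit_det _).1 h), Matrix.mul_one]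

theorem blocks_mul {n : ℕ} (g h : integerSO n) :
    fromBlocks (toRealMatrix (g * h)).toBlocks₁₁ (toRealMatrix (g * h)).toBlocks₁₂
      (toRealMatrix (g * h)).toBlocks₂₁ (toRealMatrix (g * h)).toBlocks₂₂ =
    fromBlocks (toRealMatrix g).toBlocks₁₁ (toRealMatrix g).toBlocks₁₂
      (toRealMatrix g).toBlocks₂₁ (toRealMatrix g).toBlocks₂₂ *
    fromBlocks (toRealMatrix h).toBlocks₁₁ (toRealMatrix h).toBlocks₁₂
      (toRealMatrix h).toBlocks₂₁ (toRealMatrix h).toBlocks₂₂ := by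
  simp only [fromBlocks_toBlocks, toRealMatrix_mul]

theorem numer_mul {n : ℕ} (g h : integerSO n) (θ : Antisymm n) (hθ : IsDefinedAt h θ) :
    numer (g * h) θ = numer g (moebius h θ hθ) * denom h θ := by
  have hb := blocks_mul g h
  rw [fromBlocks_multiply, fromBlocks_inj] at hb
  rw [numer, numer, hb.1, hb.2.1, Matrix.add_mul _ _ (denom h θ),
    Matrix.mul_assoc _ (moebius h θ hθ).1,
    moebius, fracAct_mul_denom hθ, numer, denom]
  simp only [Matrix.mul_add, Matrix.add_mul, Matrix.mul_assoc]
  abel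

theorem denom_mul {n : ℕ} (g h : integerSO n) (θ : Antisymm n) (hθ : IsDefinedAt h θ) :
    denom (g * h) θ = denom g (moebius h θ hθ) * denom h θ := by
  have hb := blocks_mul g h
  rw [fromBlocks_multiply, fromBlocks_inj] at hb
  rw [denom, denom.eq_1 g, hb.2.2.1, hb.2.2.2, Matrix.add_mul _ _ (denom h θ),
    Matrix.mul_assoc _ (moebius h θ hθ).1, moebius, fracAct_mul_denom hθ, numer, denom]
  simp only [Matrix.mul_add, Matrix.add_mul, Matrix.mul_assoc]
  abel

/-- By the cocycle identity the denominator of `k` at `gθ` is a factor of that of `k * g` at `θ`. -/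
theorem moebius_mem_antisymmZero {n : ℕ} (g : integerSO n) {θ : Antisymm n}
    (hθ : θ ∈ antisymmZero n) : moebius g θ (hθ g) ∈ antisymmZero n := by
  intro k
  have h := hθ (k * g)
  rw [isDefinedAt_iff, denom_mul k g θ (hθ g), det_mul] at h
  rw [isDefinedAt_iff]
  exact left_ne_zero_of_mul h

theorem fracAct_mul {n : ℕ} (g h : integerSO n) (θ : Antisymm n) (hθ : IsDefinedAt h θ) :
    fracAct (g * h) θ = fracAct g (moebius h θ hθ) := by
  rw [fracAct, numer_mul g h θ hθ, denom_mul g h θ hθ, Matrix.mul_inv_rev, Matrix.mul_assoc,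
    ← Matrix.mul_assoc (denom h θ), mul_nonsing_inv _ ((isUnit_iff_isUnit_det _).1 hθ),
    Matrix.one_mul, fracAct]

theorem fracAct_one {n : ℕ} (θ : Antisymm n) : fracAct 1 θ = θ.1 := by
  have h := fromBlocks_toBlocks (toRealMatrix (1 : integerSO n))
  rw [toRealMatrix_one, ← fromBlocks_one, fromBlocks_inj] at h
  rw [fracAct, numer, denom, toRealMatrix_one, ← fromBlocks_one, h.1, h.2.1, h.2.2.1, h.2.2.2]
  simp

/-- The action of `SO(n,n|ℤ)` on `𝒯_n⁰` by fractional linear transformations. -/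
@[reducible]
noncomputable def antisymmZeroAction (n : ℕ) : MulAction (integerSO n) (antisymmZero n) where
  smul g θ := ⟨moebius g θ.1 (θ.2 g), moebius_mem_antisymmZero g θ.2⟩
  one_smul θ := Subtype.ext (Subtype.ext (fracAct_one θ.1))
  mul_smul g h θ := Subtype.ext (Subtype.ext (fracAct_mul g h θ.1 (θ.2 h)))

theorem image_fracAct_antisymmZero {n : ℕ} (g : integerSO n) :
    (fun θ : Antisymm n => fracAct g θ) '' antisymmZero n =
      (fun θ : Antisymm n => θ.1) '' antisymmZero n := by
  apply Set.Subset.antisymm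
  · rintro _ ⟨θ, hθ, rfl⟩
    exact ⟨_, moebius_mem_antisymmZero g hθ, rfl⟩
  · rintro _ ⟨θ, hθ, rfl⟩
    refine ⟨_, moebius_mem_antisymmZero g⁻¹ hθ, ?_⟩
    change fracAct g (moebius g⁻¹ θ (hθ g⁻¹)) = θ.1
    rw [← fracAct_mul, mul_inv_cancel, fracAct_one]

end SplitOrthogonal

open SplitOrthogonal in
/-- `𝒯_n⁰` is dense and of the second category in `𝒯_n`, every `g ∈ SO(n,n|ℤ)` carries it onto
itself, and `(g, θ) ↦ gθ` is an action of the group `SO(n,n|ℤ)` on it. -/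
theorem mainTheorem4 (n : ℕ) :
    Dense (antisymmZero n) ∧
    ¬ IsMeagre (antisymmZero n) ∧
    (∀ g : integerSO n,
      (fun θ : Antisymm n => fracAct g θ) '' antisymmZero n =
        (fun θ : Antisymm n => θ.1) '' antisymmZero n) ∧
    (∃ act : MulAction (integerSO n) (antisymmZero n),
      ∀ (g : integerSO n) (θ : antisymmZero n), (act.smul g θ).1.1 = fracAct g θ.1) := by

  exact ⟨dense_of_mem_residual (antisymmZero_mem_residual n), not_isMeagre_antisymmZero n,
    image_fracAct_antisymmZero, antisymmZeroAction n, fun _ _ => rfl⟩
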